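/- Conventions. For $x,y\in\mathbb{R}^n$ write $x\gg y$ if $x_i>y_i$ for all $i$; a real-valued function $u$ on a subset of $\mathbb{R}^n$ is \emph{increasing} if $u(x)>u(y)$ whenever $x\gg y$ (for $n=1$ this is strict monotonicity). A subset $X\subset\mathbb{R}^n$ is a \emph{$d$-dimensional $C^1$ manifold} if each of its points has a relatively open neighborhood in $X$ that is $C^1$ diffeomorphic to an open subset of $\mathbb{R}^d$ (a map on a subset of $\mathbb{R}^m$ being $C^1$ if near each point of the subset it is the restriction of a $C^1$ map defined on an open ball). Its tangent space $T_x(X)$ is the range of $D\varphi(w)$ for any local parametrization $\varphi$ with $\varphi(w)=x$, and $g$ is a \emph{normal vector field} of $X$ if $g(x)\cdot v=0$ for all $x\in X$, $v\in T_x(X)$. Let $U\subset\mathbb{R}^n$ be open and let $g:U\to\mathbb{R}^n\setminus\{0\}$ be locally Lipschitz. A function $u:V\to\mathbb{R}$ is a \emph{normal solution} to $\nabla u(x)=\lambda(x)g(x)$ if (1) $V$ is open and $V\subset U$; (2) $u$ is locally Lipschitz; (3) every level set of $u$ is an $(n-1)$-dimensional $C^1$ manifold; (4) $g$ is a normal vector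 field of every level set of $u$; (5) $u$ has no local maximum point and no local minimum point; (6) $\nabla u(x)\neq 0$ at every point $x$ at which $u$ is differentiable. A normal solution $u:V\to\mathbb{R}$ is \emph{regular} if $V$ is connected and, for every $x\in V$, the function $t\mapsto u(x+tg(x))$ is (strictly) increasing on a neighborhood of $0$. \textbf{Statement.} Let $I\subset\mathbb{R}$ be a nonempty open interval (bounded or not), let $U=I^n$, and let $g:U\to\mathbb{R}^n_+\setminus\{0\}$ be locally Lipschitz, where $\mathbb{R}^n_+=\{x\in\mathbb{R}^n : x_i\ge 0 \text{ for all } i\}$. Then every regular solution $u:U\to\mathbb{R}$ to $\nabla u=\lambda g$ is increasing, and all its (nonempty) level sets are connected. Moreover, if $u_1,u_2:U\to\mathbb{R}$ are two normal solutions to $\nabla u=\lambda g$ defined on all of $U$, then $u_2$ is a monotone transform of $u_1$: there is a function $\varphi:u_1(U)\to\mathbb{R}$, either strictly increasing or strictly decreasing, such that $u_2=\varphi\circ u_1$ on $U$. -/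

import Mathlib

/-- `f` is `C^k` on an arbitrary subset `X` (in the sense of Milnor, Guillemin and Pollack):
around each point of `X` it coincides on `X` with a `C^k` map defined on a ball of the
ambient space. -/
def IsCkOnSubset {E F : Type*} [NormedAddCommGroup E] [NormedSpace ℝ E]
    [NormedAddCommGroup F] [NormedSpace ℝ F]
    (k : WithTop ℕ∞) (f : E → F) (X : Set E) : Prop :=
  ∀ x ∈ X, ∃ r : ℝ, 0 < r ∧ ∃ G : E → F, ContDiffOn ℝ k G (Metric.ball x r) ∧
    ∀ y ∈ X ∩ Metric.ball x r, G y = f y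

/-- `f` restricts to a `C^k` diffeomorphism (a bijection, `C^k` with its inverse) of the
subset `X` onto the subset `Y`. -/
def IsCkDiffeoOn {E F : Type*} [NormedAddCommGroup E] [NormedSpace ℝ E]
    [NormedAddCommGroup F] [NormedSpace ℝ F]
    (k : WithTop ℕ∞) (f : E → F) (X : Set E) (Y : Set F) : Prop :=
  Set.BijOn f X Y ∧ IsCkOnSubset k f X ∧
    ∃ h : F → E, Set.InvOn h f X Y ∧ IsCkOnSubset k h Y

/-- `φ : W → V` is a `d`-dimensional `C^k` local parametrization of the set `X`: the set `W` is
open in `ℝ^d`, the set `V` is a relatively open subset of `X`, and `φ` is a `C^k` diffeomorphism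
from `W` onto `V`. -/
def IsLocalParametrization {N d : ℕ} (k : WithTop ℕ∞) (X : Set (EuclideanSpace ℝ (Fin N)))
    (φ : EuclideanSpace ℝ (Fin d) → EuclideanSpace ℝ (Fin N))
    (W : Set (EuclideanSpace ℝ (Fin d))) (V : Set (EuclideanSpace ℝ (Fin N))) : Prop :=
  IsOpen W ∧ (∃ O : Set (EuclideanSpace ℝ (Fin N)), IsOpen O ∧ V = X ∩ O) ∧
    IsCkDiffeoOn k φ W V

/-- `X ⊆ ℝ^N` is a `d`-dimensional `C^k` (sub)manifold: every point of `X` lies in the image of a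
local parametrization. -/
def IsCkManifold {N : ℕ} (d : ℕ) (k : WithTop ℕ∞) (X : Set (EuclideanSpace ℝ (Fin N))) : Prop :=
  ∀ x ∈ X, ∃ (φ : EuclideanSpace ℝ (Fin d) → EuclideanSpace ℝ (Fin N))
    (W : Set (EuclideanSpace ℝ (Fin d))) (V : Set (EuclideanSpace ℝ (Fin N))),
    IsLocalParametrization k X φ W V ∧ x ∈ V

/-- The tangent space `T_x(X)` of a `d`-dimensional `C^1` manifold `X ⊆ ℝ^N` at `x`: the range of
`Dφ(w)`, for `φ` a local parametrization with `φ(w) = x` (the range is the same for all of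
them). -/
def manifoldTangent {N : ℕ} (d : ℕ) (X : Set (EuclideanSpace ℝ (Fin N)))
    (x : EuclideanSpace ℝ (Fin N)) : Set (EuclideanSpace ℝ (Fin N)) :=
  {v | ∃ (φ : EuclideanSpace ℝ (Fin d) → EuclideanSpace ℝ (Fin N))
    (W : Set (EuclideanSpace ℝ (Fin d))) (V : Set (EuclideanSpace ℝ (Fin N)))
    (w : EuclideanSpace ℝ (Fin d)),
    IsLocalParametrization 1 X φ W V ∧ w ∈ W ∧ φ w = x ∧ v ∈ Set.range (fderiv ℝ φ w)}

/-- `g` is a normal vector field of the `d`-dimensional `C^1` manifold `X`. -/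
def IsNormalVectorField {N : ℕ} (d : ℕ)
    (g : EuclideanSpace ℝ (Fin N) → EuclideanSpace ℝ (Fin N))
    (X : Set (EuclideanSpace ℝ (Fin N))) : Prop :=
  ∀ x ∈ X, ∀ v ∈ manifoldTangent d X x, inner ℝ (g x) v = 0

/-- The level set at height `c` of the function `u` with domain `V`. -/
def levelSetOn {n : ℕ} (V : Set (EuclideanSpace ℝ (Fin n))) (u : EuclideanSpace ℝ (Fin n) → ℝ)
    (c : ℝ) : Set (EuclideanSpace ℝ (Fin n)) :=
  {x | x ∈ V ∧ u x = c}

/-- `u : V → ℝ` is a normal solution of the total differential equation `∇u = λ g`, where `g` is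
given on `U`. Only the values of `u` on `V` and of `g` on `U` matter. -/
structure IsNormalSolution {n : ℕ} (U : Set (EuclideanSpace ℝ (Fin n)))
    (g : EuclideanSpace ℝ (Fin n) → EuclideanSpace ℝ (Fin n))
    (V : Set (EuclideanSpace ℝ (Fin n))) (u : EuclideanSpace ℝ (Fin n) → ℝ) : Prop where
  isOpen_domain : IsOpen V
  domain_subset : V ⊆ U
  locallyLipschitz : LocallyLipschitzOn V u
  levelSet_manifold : ∀ c : ℝ, IsCkManifold (n - 1) 1 (levelSetOn V u c)
  levelSet_normal : ∀ c : ℝ, IsNormalVectorField (n - 1) g (levelSetOn V u c)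
  no_localMax : ∀ x ∈ V, ¬ IsLocalMaxOn u V x
  no_localMin : ∀ x ∈ V, ¬ IsLocalMinOn u V x
  gradient_ne_zero : ∀ x ∈ V, DifferentiableAt ℝ u x → gradient u x ≠ 0

/-- `u : V → ℝ` is a regular solution: a normal solution with connected domain such that, for each
`x ∈ V`, the function `t ↦ u (x + t g(x))` is (strictly) increasing around `0`. -/
structure IsRegularSolution {n : ℕ} (U : Set (EuclideanSpace ℝ (Fin n)))
    (g : EuclideanSpace ℝ (Fin n) → EuclideanSpace ℝ (Fin n))
    (V : Set (EuclideanSpace ℝ (Fin n))) (u : EuclideanSpace ℝ (Fin n) → ℝ) : Prop where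
  isNormalSolution : IsNormalSolution U g V u
  isConnected_domain : IsConnected V
  increasing_along : ∀ x ∈ V, ∃ ε : ℝ, 0 < ε ∧
    (∀ t ∈ Set.Ioo (-ε) ε, x + t • g x ∈ V) ∧
    StrictMonoOn (fun t : ℝ => u (x + t • g x)) (Set.Ioo (-ε) ε)

/-- `u` is increasing on `V`: `u(y) < u(x)` whenever `x ≫ y`, that is, `y i < x i` for all `i`. -/
def IsIncreasingOn {n : ℕ} (V : Set (EuclideanSpace ℝ (Fin n)))
    (u : EuclideanSpace ℝ (Fin n) → ℝ) : Prop :=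
  ∀ x ∈ V, ∀ y ∈ V, (∀ i, y i < x i) → u y < u x

/-- `u₂` is a monotone transform of `u₁` on `V`: `u₂ = φ ∘ u₁` for a function `φ` on the range of
`u₁` that is either (strictly) increasing or (strictly) decreasing. -/
def IsMonotoneTransformOn {n : ℕ} (V : Set (EuclideanSpace ℝ (Fin n)))
    (u₁ u₂ : EuclideanSpace ℝ (Fin n) → ℝ) : Prop :=
  ∃ φ : ℝ → ℝ, (StrictMonoOn φ (u₁ '' V) ∨ StrictAntiOn φ (u₁ '' V)) ∧
    ∀ x ∈ V, u₂ x = φ (u₁ x)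

/-- The cube `I^n` in `ℝ^n`. -/
def cube (n : ℕ) (I : Set ℝ) : Set (EuclideanSpace ℝ (Fin n)) :=
  {x | ∀ i, x i ∈ I}

/-! Everything rests on a local uniqueness statement, `IsNormalSolution.exists_common_level_point`.
Fix `v` transversal to `g`. In the plane through `z` and a nearby `z'` with direction `v`, a level
surface is locally a curve whose slope is the quotient of inner products `⟨g, a⟩ / ⟨g, v⟩`, where `a
= z' - z`. This slope field is Lipschitz, so curves from `z'` belonging to two solutions can be
continued to one common point of the line `z + ℝ v`. A solution may have many level points over one
parameter, so uniqueness is proved for closed sets rather than functions (`exists_common_endpoint`).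

Taking the same solution twice, all values of `u` near `z` occur on the line `z + ℝ v` near `z`. An
extremum of `u` along a transversal segment would therefore be a local extremum of `u`, so by Rolle
`u` differs at the ends. Since `g` is nonnegative and nonzero, every `v ≫ 0` is transversal; the
pairs `x ≫ y` form a connected set, so `u` or `-u` is increasing, and regularity selects `u`.
Monotonicity lets any two points of a level set be joined by a curve in it.

For two solutions, local uniqueness makes `u₂` locally constant on each level set of `u₁`, hence
constant by connectedness. Comparing both along a segment of direction `≫ 0` gives the monotone
transform. -/

open Set Filter Topology
open scoped NNReal

/-! ### Hypersurfaces as graphs over transversal directions. -/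

/-- A function that is `C^k` on a subset is `C^k` at the interior points of the subset. -/
theorem IsCkOnSubset.contDiffAt {E F : Type*} [NormedAddCommGroup E] [NormedSpace ℝ E]
    [NormedAddCommGroup F] [NormedSpace ℝ F] {k : WithTop ℕ∞} {f : E → F} {X : Set E} {x : E}
    (hf : IsCkOnSubset k f X) (hX : X ∈ 𝓝 x) : ContDiffAt ℝ k f x := by
  obtain ⟨r, hr, G, hG, hGf⟩ := hf x (mem_of_mem_nhds hX)
  have hball : Metric.ball x r ∈ 𝓝 x := Metric.ball_mem_nhds x hr
  refine (hG.contDiffAt hball).congr_of_eventuallyEq ?_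
  filter_upwards [hX, hball] with y hy hy'
  exact (hGf y ⟨hy, hy'⟩).symm

/-- The derivative of a `C^1` diffeomorphism at an interior point of its domain is injective. -/
theorem IsCkDiffeoOn.fderiv_injective {E F : Type*} [NormedAddCommGroup E] [NormedSpace ℝ E]
    [NormedAddCommGroup F] [NormedSpace ℝ F] {f : E → F} {X : Set E} {Y : Set F} {x : E}
    (hf : IsCkDiffeoOn 1 f X Y) (hX : X ∈ 𝓝 x) : Function.Injective (fderiv ℝ f x) := by
  obtain ⟨hbij, hfC, h, hinv, hhC⟩ := hf
  have hfx : DifferentiableAt ℝ f x := (hfC.contDiffAt hX).differentiableAt one_ne_zero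
  obtain ⟨r, hr, H, hH, hHh⟩ := hhC (f x) (hbij.mapsTo (mem_of_mem_nhds hX))
  have hball : Metric.ball (f x) r ∈ 𝓝 (f x) := Metric.ball_mem_nhds _ hr
  have hHx : DifferentiableAt ℝ H (f x) := (hH.contDiffAt hball).differentiableAt one_ne_zero
  have hid : H ∘ f =ᶠ[𝓝 x] id := by
    filter_upwards [hX, hfx.continuousAt.preimage_mem_nhds hball] with y hy hy'
    rw [Function.comp_apply, hHh (f y) ⟨hbij.mapsTo hy, hy'⟩]
    exact hinv.1 hy
  have hcomp : (fderiv ℝ H (f x)).comp (fderiv ℝ f x) = ContinuousLinearMap.id ℝ E := by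
    rw [← fderiv_comp x hHx hfx, hid.fderiv_eq, fderiv_id]
  intro a b hab
  have := congrArg (fderiv ℝ H (f x)) hab
  simpa using (DFunLike.congr_fun hcomp a).symm.trans (this.trans (DFunLike.congr_fun hcomp b))

/-- Near a point `p` of a hypersurface with normal field `g`, the section of the hypersurface by
the plane through `p` spanned by `a` and a transversal vector `v` contains a curve that is a graph
over the direction `a`. -/
theorem IsCkManifold.exists_transversal_graph {n : ℕ}
    {g : EuclideanSpace ℝ (Fin n) → EuclideanSpace ℝ (Fin n)}
    {M : Set (EuclideanSpace ℝ (Fin n))} (hM : IsCkManifold (n - 1) 1 M)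
    (hg : IsNormalVectorField (n - 1) g M) {p : EuclideanSpace ℝ (Fin n)} (hp : p ∈ M)
    {v : EuclideanSpace ℝ (Fin n)} (hv : inner ℝ (g p) v ≠ 0) (a : EuclideanSpace ℝ (Fin n)) :
    ∃ τ : ℝ → ℝ, HasDerivAt τ (inner ℝ (g p) a / inner ℝ (g p) v) 0 ∧ τ 0 = 0 ∧
      ∀ᶠ δ in 𝓝 (0 : ℝ), p - δ • a + τ δ • v ∈ M := by
  -- Truncated subtraction breaks this only for `n = 0`, where no vector is transversal.
  have hn : n - 1 + 1 = n := by
    rcases n with _ | n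
    · exact absurd (by rw [Subsingleton.elim v 0, inner_zero_right]) hv
    · rfl
  obtain ⟨φ, W, V, hpar, hpV⟩ := hM p hp
  obtain ⟨hW, ⟨O, -, rfl⟩, hφ⟩ := id hpar
  obtain ⟨w, hw, hwp⟩ := hφ.1.surjOn hpV
  have hWw : W ∈ 𝓝 w := hW.mem_nhds hw
  have hstrict : HasStrictFDerivAt φ (fderiv ℝ φ w) w :=
    (hφ.2.1.contDiffAt hWw).hasStrictFDerivAt one_ne_zero
  have hinj := hφ.fderiv_injective hWw
  have horth : ∀ y, inner ℝ (g p) (fderiv ℝ φ w y) = 0 := fun y =>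
    hg p hp _ ⟨φ, W, _, w, hpar, hw, hwp, y, rfl⟩
  -- The derivative at `(w, 0)` of `(y, t) ↦ φ y - t • v`. Pairing with `g p` kills the tangent
  -- part, so `v` completes the tangent hyperplane and `D` is invertible. The inverse function
  -- theorem then gives `τ` as the last coordinate of the local inverse along `p - δ • a`.
  set D : EuclideanSpace ℝ (Fin (n - 1)) × ℝ →L[ℝ] EuclideanSpace ℝ (Fin n) :=
    (fderiv ℝ φ w).comp (ContinuousLinearMap.fst ℝ _ ℝ) -
      (ContinuousLinearMap.snd ℝ (EuclideanSpace ℝ (Fin (n - 1))) ℝ).smulRight v with hD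
  have hDapply : ∀ q, D q = fderiv ℝ φ w q.1 - q.2 • v := fun q => by simp [hD]
  have hinner : ∀ q, inner ℝ (g p) (D q) = -(q.2 * inner ℝ (g p) v) := fun q => by
    rw [hDapply, inner_sub_right, horth, inner_smul_right, zero_sub]
  have hker : LinearMap.ker D.toLinearMap = ⊥ := by
    rw [LinearMap.ker_eq_bot']
    intro q hq
    have hq' : D q = 0 := hq
    have h2 : q.2 = 0 := by
      have := hinner q
      rw [hq', inner_zero_right] at this
      simpa [hv] using this.symm
    have h1 : fderiv ℝ φ w q.1 = fderiv ℝ φ w 0 := by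
      have := hDapply q
      rw [hq', h2, zero_smul, sub_zero] at this
      rw [← this, map_zero]
    exact Prod.ext (hinj h1) h2
  have hdim : Module.finrank ℝ (EuclideanSpace ℝ (Fin (n - 1)) × ℝ) =
      Module.finrank ℝ (EuclideanSpace ℝ (Fin n)) := by
    simp [hn]
  let e : (EuclideanSpace ℝ (Fin (n - 1)) × ℝ) ≃L[ℝ] EuclideanSpace ℝ (Fin n) :=
    (LinearEquiv.ofInjectiveOfFinrankEq D.toLinearMap
      (LinearMap.ker_eq_bot.1 hker) hdim).toContinuousLinearEquiv
  have he : ∀ q, e q = D q := fun q => rfl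
  have heD : (e : (EuclideanSpace ℝ (Fin (n - 1)) × ℝ) →L[ℝ] EuclideanSpace ℝ (Fin n)) = D :=
    ContinuousLinearMap.ext he
  set Ψ : EuclideanSpace ℝ (Fin (n - 1)) × ℝ → EuclideanSpace ℝ (Fin n) :=
    fun q => φ q.1 - q.2 • v with hΨ
  have hΨp : Ψ (w, 0) = p := by simp [hΨ, hwp]
  have hΨD : HasStrictFDerivAt Ψ
      (e : (EuclideanSpace ℝ (Fin (n - 1)) × ℝ) →L[ℝ] EuclideanSpace ℝ (Fin n)) (w, 0) := by
    rw [heD]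
    exact (HasStrictFDerivAt.comp (w, (0 : ℝ)) (f := Prod.fst) (g := φ) hstrict
      hasStrictFDerivAt_fst).sub (hasStrictFDerivAt_snd.smul_const v)
  obtain ⟨Φ, hΦ, hΦp, hright⟩ : ∃ Φ : EuclideanSpace ℝ (Fin n) → EuclideanSpace ℝ (Fin (n - 1)) × ℝ,
      HasFDerivAt Φ (e.symm : EuclideanSpace ℝ (Fin n) →L[ℝ] EuclideanSpace ℝ (Fin (n - 1)) × ℝ) p ∧
        Φ p = (w, 0) ∧ ∀ᶠ y in 𝓝 p, Ψ (Φ y) = y := by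
    rw [← hΨp]
    exact ⟨hΨD.localInverse Ψ e (w, 0), hΨD.to_localInverse.hasFDerivAt,
      hΨD.localInverse_apply_image, hΨD.eventually_right_inverse⟩
  have hline : HasDerivAt (fun δ : ℝ => p - δ • a) (-a) 0 := by
    simpa using ((hasDerivAt_id (0 : ℝ)).smul_const a).const_sub p
  have hcurve : HasDerivAt (fun δ : ℝ => Φ (p - δ • a)) (e.symm (-a)) 0 :=
    hΦ.comp_hasDerivAt_of_eq 0 hline (by simp)
  have hslope : (e.symm (-a)).2 = inner ℝ (g p) a / inner ℝ (g p) v := by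
    have := hinner (e.symm (-a))
    rw [← he, e.apply_symm_apply, inner_neg_right] at this
    rw [eq_div_iff hv]
    linarith
  refine ⟨fun δ => (Φ (p - δ • a)).2, ?_, by simp [hΦp], ?_⟩
  · rw [← hslope]
    exact hasFDerivAt_snd.comp_hasDerivAt (0 : ℝ) hcurve
  · have hline0 : Tendsto (fun δ : ℝ => p - δ • a) (𝓝 0) (𝓝 p) := by
      simpa using hline.continuousAt.tendsto
    have hfst : Tendsto (fun δ : ℝ => (Φ (p - δ • a)).1) (𝓝 0) (𝓝 w) := by
      simpa [Function.comp_def, hΦp] using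
        (continuous_fst.tendsto _).comp hcurve.continuousAt.tendsto
    filter_upwards [hline0.eventually hright, hfst.eventually hWw] with δ hδ hδW
    have hmem : φ (Φ (p - δ • a)).1 ∈ M ∩ O := hφ.1.mapsTo hδW
    have heq : p - δ • a + (Φ (p - δ • a)).2 • v = φ (Φ (p - δ • a)).1 := by
      rw [← sub_eq_iff_eq_add.1 hδ]
    rw [heq]
    exact hmem.1

/-! ### Uniqueness for Lipschitz slope fields. -/

/-- Two closed subsets of a strip that can be continued to the right along the same slope field,
Lipschitz in the second variable, and that share their left endpoint, have a common point at the
right end of the strip. -/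
theorem exists_common_endpoint {A : Fin 2 → Set (ℝ × ℝ)} {q : ℝ → ℝ → ℝ} {B K : ℝ} (hB : 0 ≤ B)
    (hK : 0 ≤ K) (hclosed : ∀ i, IsClosed (A i ∩ Icc 0 1 ×ˢ Icc (-B) B))
    (hq : ∀ s ∈ Icc (0 : ℝ) 1, ∀ τ ∈ Icc (-B) B, |q s τ| < B)
    (hqK : ∀ s ∈ Icc (0 : ℝ) 1, ∀ τ ∈ Icc (-B) B, ∀ τ' ∈ Icc (-B) B,
      |q s τ - q s τ'| ≤ K * |τ - τ'|)
    (hstep : ∀ i, ∀ s ∈ Icc (0 : ℝ) 1, ∀ τ ∈ Icc (-B) B, (s, τ) ∈ A i →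
      ∃ σ : ℝ → ℝ, HasDerivAt σ (q s τ) 0 ∧ σ 0 = 0 ∧ ∀ᶠ δ in 𝓝 (0 : ℝ), (s + δ, τ + σ δ) ∈ A i)
    (h0 : ∀ i, ((0 : ℝ), (0 : ℝ)) ∈ A i) :
    ∃ τ ∈ Icc (-B) B, ∀ i, ((1 : ℝ), τ) ∈ A i := by
  have happrox : ∀ ε > 0, ∃ t : Fin 2 → ℝ, (∀ i, t i ∈ Icc (-B) B ∧ ((1 : ℝ), t i) ∈ A i) ∧
      |t 0 - t 1| ≤ ε * Real.exp (K + 1) := by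
    intro ε hε
    -- Pairs of points over the same `s` whose gap obeys a Gronwall bound started at `ε`. The
    -- projection of `T` to `s` is closed, contains `0` and extends to the right of each of its
    -- points below `1`, so it covers `[0, 1]`. The condition `|t i| ≤ B * s` keeps the pairs in the
    -- strip.
    set T : Set (ℝ × (Fin 2 → ℝ)) := {x | (∀ i, (x.1, x.2 i) ∈ A i ∩ Icc 0 1 ×ˢ Icc (-B) B) ∧
      (∀ i, |x.2 i| ≤ B * x.1) ∧ |x.2 0 - x.2 1| ≤ ε * Real.exp ((K + 1) * x.1)} with hT
    have hTclosed : IsClosed T := by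
      refine IsClosed.and ?_ (IsClosed.and ?_ ?_)
      · simp only [ofPred_forall]
        exact isClosed_iInter fun i => (hclosed i).preimage (by fun_prop)
      · simp only [ofPred_forall]
        exact isClosed_iInter fun i => isClosed_le (by fun_prop) (by fun_prop)
      · exact isClosed_le (by fun_prop) (by fun_prop)
    have hTcompact : IsCompact T := by
      refine ((isCompact_Icc (a := (0 : ℝ)) (b := 1)).prod
        (isCompact_univ_pi fun _ : Fin 2 => isCompact_Icc (a := -B) (b := B))).of_isClosed_subset
        hTclosed ?_
      rintro ⟨s, t⟩ ⟨h, -⟩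
      exact ⟨(h 0).2.1, fun i _ => (h i).2.2⟩
    have hS : IsClosed (Prod.fst '' T ∩ Icc (0 : ℝ) 1) :=
      (hTcompact.image continuous_fst).isClosed.inter isClosed_Icc
    have hS0 : (0 : ℝ) ∈ Prod.fst '' T := by
      refine ⟨(0, 0), ⟨fun i => ⟨h0 i, ?_, ?_⟩, fun i => ?_, ?_⟩, rfl⟩ <;> simp [hB, hε.le]
    have hS1 := hS.Icc_subset_of_forall_exists_gt hS0 (by
      rintro s ⟨⟨⟨s', t⟩, ⟨htA, htB, htε⟩, rfl : s' = s⟩, hs⟩ y hy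
      simp only at htA htB htε
      choose σ hσ hσ0 hσA using fun i =>
        hstep i s' (htA i).2.1 (t i) (htA i).2.2 (htA i).1
      have hexp : 0 < ε * Real.exp ((K + 1) * s') := by positivity
      have hlim : ∀ i, ∀ η > 0, ∀ᶠ δ in 𝓝[>] (0 : ℝ), |σ i δ - δ * q s' (t i)| ≤ η * δ := by
        intro i η hη
        have := ((hasDerivAt_iff_isLittleO.1 (hσ i)).def hη).filter_mono
          (nhdsWithin_le_nhds (s := Ioi 0))
        filter_upwards [this, self_mem_nhdsWithin] with δ hδ hδ0
        simpa [hσ0 i, abs_of_pos (mem_Ioi.1 hδ0)] using hδ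
      have hη : ∀ i, ∀ᶠ δ in 𝓝[>] (0 : ℝ), |σ i δ - δ * q s' (t i)| ≤ (B - |q s' (t i)|) * δ :=
        fun i => hlim i _ (sub_pos.2 (hq s' (htA i).2.1 _ (htA i).2.2))
      -- Two errors of half size each: their sum is what the rate `K + 1` leaves over after the
      -- Lipschitz growth at rate `K`.
      have hη' : ∀ i, ∀ᶠ δ in 𝓝[>] (0 : ℝ),
          |σ i δ - δ * q s' (t i)| ≤ (ε * Real.exp ((K + 1) * s') / 2) * δ :=
        fun i => hlim i _ (half_pos hexp)
      have hsmall : ∀ᶠ δ in 𝓝[>] (0 : ℝ), δ ≤ min (1 - s') (y - s') :=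
        nhdsWithin_le_nhds (Iic_mem_nhds (lt_min (sub_pos.2 hs.2) (sub_pos.2 hy)))
      obtain ⟨δ, hδ0, hδs, hδB, hδε, hδA⟩ := (eventually_mem_nhdsWithin.and (hsmall.and
        ((eventually_all.2 hη).and ((eventually_all.2 hη').and
          ((eventually_all.2 hσA).filter_mono nhdsWithin_le_nhds))))).exists
      have hδ0 : 0 < δ := hδ0
      have hδ1 := hδs.trans (min_le_left _ _)
      have hδy := hδs.trans (min_le_right _ _)
      have hbound : ∀ i, |t i + σ i δ| ≤ B * (s' + δ) := by
        intro i
        have h1 : |t i + σ i δ| ≤ |t i| + |δ * q s' (t i)| + |σ i δ - δ * q s' (t i)| := by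
          calc |t i + σ i δ| = |t i + δ * q s' (t i) + (σ i δ - δ * q s' (t i))| := by ring_nf
            _ ≤ _ := (abs_add_le _ _).trans (add_le_add_left (abs_add_le _ _) _)
        rw [abs_mul, abs_of_pos hδ0] at h1
        linarith [htB i, hδB i]
      have hs1 : s' + δ ≤ 1 := by linarith
      have hbox : ∀ i, t i + σ i δ ∈ Icc (-B) B := fun i =>
        abs_le.1 ((hbound i).trans (by nlinarith))
      refine ⟨s' + δ, ⟨(s' + δ, fun i => t i + σ i δ), ⟨fun i => ⟨hδA i, ⟨?_, hs1⟩, hbox i⟩,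
        hbound, ?_⟩, rfl⟩, by linarith, by linarith⟩
      · linarith [hs.1]
      · simp only
        have hKt := hqK s' (htA 0).2.1 _ (htA 0).2.2 _ (htA 1).2.2
        have h1 : |t 0 + σ 0 δ - (t 1 + σ 1 δ)| ≤ |t 0 - t 1| + δ * |q s' (t 0) - q s' (t 1)| +
            |σ 0 δ - δ * q s' (t 0)| + |σ 1 δ - δ * q s' (t 1)| := by
          calc |t 0 + σ 0 δ - (t 1 + σ 1 δ)| = |(t 0 - t 1) + δ * (q s' (t 0) - q s' (t 1)) +
                (σ 0 δ - δ * q s' (t 0)) - (σ 1 δ - δ * q s' (t 1))| := by ring_nf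
            _ ≤ _ := by
              refine (abs_sub _ _).trans (add_le_add_left ((abs_add_le _ _).trans
                (add_le_add_left ((abs_add_le _ _).trans ?_) _)) _)
              rw [abs_mul, abs_of_pos hδ0]
        have h2 := mul_le_mul_of_nonneg_left hKt hδ0.le
        have h3 : K * |t 0 - t 1| ≤ K * (ε * Real.exp ((K + 1) * s')) := by gcongr
        have h4 := mul_le_mul_of_nonneg_left h3 hδ0.le
        have h5 : ε * Real.exp ((K + 1) * (s' + δ)) ≥
            ε * Real.exp ((K + 1) * s') * ((K + 1) * δ + 1) := by
          rw [mul_add (K + 1), Real.exp_add, ← mul_assoc]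
          exact mul_le_mul_of_nonneg_left (Real.add_one_le_exp _) hexp.le
        linarith [hδε 0, hδε 1])
    obtain ⟨⟨s, t⟩, ⟨htA, -, htε⟩, hs : s = 1⟩ := hS1 (right_mem_Icc.2 zero_le_one)
    subst hs
    exact ⟨t, fun i => ⟨(htA i).2.2, (htA i).1⟩, by simpa using htε⟩
  set C : Set (Fin 2 → ℝ) := {t | ∀ i, ((1 : ℝ), t i) ∈ A i ∩ Icc 0 1 ×ˢ Icc (-B) B} with hC
  have hCcompact : IsCompact C := by
    refine (isCompact_univ_pi fun _ : Fin 2 => isCompact_Icc (a := -B) (b := B)).of_isClosed_subset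
      ?_ fun t h i _ => (h i).2.2
    simp only [hC, ofPred_forall]
    exact isClosed_iInter fun i => (hclosed i).preimage (by fun_prop)
  have hmem : ∀ t : Fin 2 → ℝ, (∀ i, t i ∈ Icc (-B) B ∧ ((1 : ℝ), t i) ∈ A i) → t ∈ C :=
    fun t h i => ⟨(h i).2, right_mem_Icc.2 zero_le_one, (h i).1⟩
  have hCne : C.Nonempty := by
    obtain ⟨t, ht, -⟩ := happrox 1 one_pos
    exact ⟨t, hmem t ht⟩
  -- The smallest gap over `s = 1` is attained, and arbitrarily small gaps occur, so it is zero.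
  obtain ⟨t, ht, htmin⟩ := hCcompact.exists_isMinOn hCne
    (f := fun t => |t 0 - t 1|) (by fun_prop)
  have hle : |t 0 - t 1| ≤ 0 := by
    refine le_of_forall_pos_le_add fun ε hε => ?_
    obtain ⟨t', ht', hε'⟩ := happrox (ε / Real.exp (K + 1)) (by positivity)
    have := (htmin (hmem t' ht')).trans hε'
    rwa [div_mul_cancel₀ _ (Real.exp_ne_zero _), ← zero_add ε] at this
  have heq : t 0 = t 1 := by simpa [sub_eq_zero] using hle
  refine ⟨t 0, (ht 0).2.2, fun i => ?_⟩
  fin_cases i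
  · exact (ht 0).1
  · simpa [heq] using (ht 1).1

/-! ### Level surfaces of normal solutions along a transversal line. -/

/-- If `g` is locally Lipschitz and transversal to `v` at `z`, the slope over `v` of the hyperplanes
orthogonal to `g` is bounded and Lipschitz near `z`. -/
theorem exists_bound_lipschitz_slope {E : Type*} [NormedAddCommGroup E] [InnerProductSpace ℝ E]
    {U : Set E} (hU : IsOpen U) {g : E → E} (hg : LocallyLipschitzOn U g) {z : E} (hz : z ∈ U)
    {v : E} (hv : inner ℝ (g z) v ≠ 0) :
    ∃ K C r : ℝ, 0 ≤ K ∧ 0 ≤ C ∧ 0 < r ∧ Metric.ball z r ⊆ U ∧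
      (∀ p ∈ Metric.ball z r, ∀ a, |inner ℝ (g p) a / inner ℝ (g p) v| ≤ C * ‖a‖) ∧
      ∀ p ∈ Metric.ball z r, ∀ p' ∈ Metric.ball z r, ∀ a,
        |inner ℝ (g p) a / inner ℝ (g p) v - inner ℝ (g p') a / inner ℝ (g p') v| ≤
          K * ‖a‖ * ‖p - p'‖ := by
  -- Rescaling `g` to have inner product `1` with `v` makes the slope linear in `N (g p)`; `N` is
  -- `C^1` near `g z`.
  set N : E → E := fun y => (inner ℝ y v)⁻¹ • y
  have hN : ContDiffAt ℝ 1 N (g z) :=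
    ((contDiffAt_id.inner ℝ contDiffAt_const).inv hv).smul contDiffAt_id
  obtain ⟨K₁, t, ht, hNt⟩ := hN.exists_lipschitzOnWith
  obtain ⟨K₂, s, hs, hgs⟩ := hg hz
  rw [hU.nhdsWithin_eq hz] at hs
  have hgz : ContinuousAt g z := hg.continuousOn.continuousAt (hU.mem_nhds hz)
  obtain ⟨r, hr, hball⟩ := Metric.mem_nhds_iff.1
    (inter_mem (hU.mem_nhds hz) (inter_mem hs (hgz.preimage_mem_nhds ht)))
  have hlip : LipschitzOnWith (K₁ * K₂) (N ∘ g) (Metric.ball z r) :=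
    hNt.comp (hgs.mono fun p hp => (hball hp).2.1) fun p hp => (hball hp).2.2
  have hslope : ∀ p a, inner ℝ (g p) a / inner ℝ (g p) v = inner ℝ (N (g p)) a := fun p a => by
    simp only [N, real_inner_smul_left]
    ring
  have hzr : z ∈ Metric.ball z r := Metric.mem_ball_self hr
  have hL : ∀ p ∈ Metric.ball z r, ∀ p' ∈ Metric.ball z r,
      ‖N (g p) - N (g p')‖ ≤ (K₁ * K₂ : ℝ≥0) * ‖p - p'‖ := fun p hp p' hp' =>
    hlip.norm_sub_le hp hp'
  refine ⟨(K₁ * K₂ : ℝ≥0), ‖N (g z)‖ + (K₁ * K₂ : ℝ≥0) * r, r, by positivity, by positivity, hr,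
    fun p hp => (hball hp).1, fun p hp a => ?_, fun p hp p' hp' a => ?_⟩
  · rw [hslope]
    refine (abs_real_inner_le_norm _ _).trans (mul_le_mul_of_nonneg_right ?_ (norm_nonneg _))
    have h1 := hL p hp z hzr
    have h2 : ((K₁ * K₂ : ℝ≥0) : ℝ) * ‖p - z‖ ≤ (K₁ * K₂ : ℝ≥0) * r := by
      gcongr
      exact (mem_ball_iff_norm.1 hp).le
    have h3 := norm_sub_norm_le (N (g p)) (N (g z))
    linarith
  · rw [hslope, hslope, ← inner_sub_left]
    refine (abs_real_inner_le_norm _ _).trans ?_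
    have := mul_le_mul_of_nonneg_right (hL p hp p' hp') (norm_nonneg a)
    linarith

/-- If `v` is transversal to `g`, the level surfaces of two normal solutions through a common point
`z'` close to `z` meet the line `z + ℝ v` at a common point close to `z`. -/
theorem IsNormalSolution.exists_common_level_point {n : ℕ}
    {U : Set (EuclideanSpace ℝ (Fin n))}
    {g : EuclideanSpace ℝ (Fin n) → EuclideanSpace ℝ (Fin n)} (hg : LocallyLipschitzOn U g)
    {u : Fin 2 → EuclideanSpace ℝ (Fin n) → ℝ} (hu : ∀ i, IsNormalSolution U g U (u i))
    {v : EuclideanSpace ℝ (Fin n)} (hv : ∀ p ∈ U, inner ℝ (g p) v ≠ 0)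
    {z : EuclideanSpace ℝ (Fin n)} (hz : z ∈ U) {ε : ℝ} (hε : 0 < ε) :
    ∀ᶠ z' in 𝓝 z, ∃ τ : ℝ, |τ| < ε ∧ ∀ i, u i (z + τ • v) = u i z' := by
  obtain ⟨K, C, r, hK, hC, hr, hball, hqC, hqK⟩ :=
    exists_bound_lipschitz_slope (hu 0).isOpen_domain hg hz (hv z hz)
  have hsmall : ∀ᶠ z' in 𝓝 z, ‖z' - z‖ * (1 + (C + 1) * ‖v‖) < r := by
    have hcont : ContinuousAt (fun z' => ‖z' - z‖ * (1 + (C + 1) * ‖v‖)) z := by fun_prop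
    exact hcont.eventually_lt continuousAt_const (by simpa using hr)
  have hsmall' : ∀ᶠ z' in 𝓝 z, (C + 1) * ‖z' - z‖ < ε := by
    have hcont : ContinuousAt (fun z' => (C + 1) * ‖z' - z‖) z := by fun_prop
    exact hcont.eventually_lt continuousAt_const (by simpa using hε)
  filter_upwards [hsmall, hsmall'] with z' hz' hzε
  rcases eq_or_ne z' z with rfl | hne
  · exact ⟨0, by simpa using hε, by simp⟩
  set a := z' - z with ha
  have ha0 : 0 < ‖a‖ := norm_pos_iff.2 (sub_ne_zero.2 hne)
  -- `s = 0, τ = 0` is `z'`, and `s = 1` is the line `z + ℝ v`. The slopes are at most `C * ‖a‖`, so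
  -- half-width `(C + 1) * ‖a‖` gives the strict bound needed, as `a ≠ 0`.
  set y : ℝ → ℝ → EuclideanSpace ℝ (Fin n) := fun s τ => z + (1 - s) • a + τ • v with hy
  have hyball : ∀ s ∈ Icc (0 : ℝ) 1, ∀ τ ∈ Icc (-((C + 1) * ‖a‖)) ((C + 1) * ‖a‖),
      y s τ ∈ Metric.ball z r := by
    intro s hs τ hτ
    rw [mem_ball_iff_norm]
    have h1 : y s τ - z = (1 - s) • a + τ • v := by simp only [hy]; abel
    have h2 : |1 - s| * ‖a‖ ≤ 1 * ‖a‖ := by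
      gcongr
      exact abs_le.2 ⟨by linarith [hs.2], by linarith [hs.1]⟩
    have h3 : |τ| * ‖v‖ ≤ ((C + 1) * ‖a‖) * ‖v‖ := by
      gcongr
      exact abs_le.2 hτ
    calc ‖y s τ - z‖ ≤ |1 - s| * ‖a‖ + |τ| * ‖v‖ := by
          rw [h1]
          refine (norm_add_le _ _).trans_eq ?_
          rw [norm_smul, norm_smul, Real.norm_eq_abs, Real.norm_eq_abs]
      _ < r := by linarith
  have hend := exists_common_endpoint
    (A := fun i => {x : ℝ × ℝ | u i (y x.1 x.2) = u i z'})
    (q := fun s τ => inner ℝ (g (y s τ)) a / inner ℝ (g (y s τ)) v)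
    (B := (C + 1) * ‖a‖) (K := K * ‖a‖ * ‖v‖) (by positivity) (by positivity)
    (fun i => ?_) (fun s hs τ hτ => ?_) (fun s hs τ hτ τ' hτ' => ?_)
    (fun i s hs τ hτ hmem => ?_) (fun i => ?_)
  · obtain ⟨τ, hτ, hτu⟩ := hend
    refine ⟨τ, (abs_le.2 hτ).trans_lt hzε, fun i => ?_⟩
    simpa [hy] using hτu i
  · rw [inter_comm]
    refine ContinuousOn.preimage_isClosed_of_isClosed (t := {u i z'})
      (f := fun x : ℝ × ℝ => u i (y x.1 x.2)) ?_ (isClosed_Icc.prod isClosed_Icc)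
      isClosed_singleton
    exact (hu i).locallyLipschitz.continuousOn.comp (by fun_prop)
      fun x hx => hball (hyball x.1 hx.1 x.2 hx.2)
  · have := hqC _ (hyball s hs τ hτ) a
    linarith
  · refine (hqK _ (hyball s hs τ hτ) _ (hyball s hs τ' hτ') a).trans_eq ?_
    have h1 : y s τ - y s τ' = (τ - τ') • v := by simp only [hy, sub_smul]; abel
    rw [h1, norm_smul, Real.norm_eq_abs]
    ring
  · have hp := hball (hyball s hs τ hτ)
    obtain ⟨σ, hσ, hσ0, hσM⟩ := ((hu i).levelSet_manifold (u i z')).exists_transversal_graph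
      ((hu i).levelSet_normal _) (p := y s τ) ⟨hp, hmem⟩ (hv _ hp) a
    refine ⟨σ, hσ, hσ0, ?_⟩
    filter_upwards [hσM] with δ hδ
    have h1 : y (s + δ) (τ + σ δ) = y s τ - δ • a + σ δ • v := by
      simp only [hy]
      module
    change u i (y (s + δ) (τ + σ δ)) = u i z'
    rw [h1]
    exact hδ.2
  · simp [hy, ha]

/-- A normal solution takes different values at two points of a convex domain whose difference is
transversal to `g`. -/
theorem IsNormalSolution.apply_ne_of_transversal {n : ℕ}
    {U : Set (EuclideanSpace ℝ (Fin n))} (hU : Convex ℝ U)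
    {g : EuclideanSpace ℝ (Fin n) → EuclideanSpace ℝ (Fin n)} (hg : LocallyLipschitzOn U g)
    {u : EuclideanSpace ℝ (Fin n) → ℝ} (hu : IsNormalSolution U g U u)
    {x y : EuclideanSpace ℝ (Fin n)} (hx : x ∈ U) (hy : y ∈ U)
    (hv : ∀ p ∈ U, inner ℝ (g p) (x - y) ≠ 0) : u y ≠ u x := by
  intro heq
  set f : ℝ → ℝ := fun t => u (y + t • (x - y)) with hf
  have hmem : ∀ t ∈ Icc (0 : ℝ) 1, y + t • (x - y) ∈ U := fun t ht =>
    hU.add_smul_sub_mem hy hx ht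
  have hfc : ContinuousOn f (Icc 0 1) :=
    hu.locallyLipschitz.continuousOn.comp (by fun_prop) hmem
  obtain ⟨c, hc, hext⟩ := exists_isLocalExtr_Ioo zero_lt_one hfc (by simpa [hf] using heq)
  have hz := hmem c (Ioo_subset_Icc_self hc)
  set z := y + c • (x - y) with hzdef
  have hshift : ∀ τ : ℝ, u (z + τ • (x - y)) = f (c + τ) := fun τ => by
    simp only [hf, hzdef, add_smul, add_assoc]
  -- Values of `u` near `z` are values of `f` near `c`, so an extremum of `f` at `c` is one of `u`
  -- at `z`.
  have hnear : ∀ {P : ℝ → Prop}, (∀ᶠ t in 𝓝 c, P (f t)) → ∀ᶠ z' in 𝓝 z, P (u z') := by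
    intro P hP
    obtain ⟨ε, hε, hball⟩ := Metric.eventually_nhds_iff.1 hP
    filter_upwards [IsNormalSolution.exists_common_level_point hg (fun _ : Fin 2 => hu) hv hz hε]
      with z' ⟨τ, hτ, hτu⟩
    rw [← hτu 0, hshift]
    exact hball (by simpa using hτ)
  rcases hext with hmin | hmax
  · exact hu.no_localMin z hz (hnear (P := fun s => u z ≤ s) hmin |>.filter_mono
      nhdsWithin_le_nhds)
  · exact hu.no_localMax z hz (hnear (P := fun s => s ≤ u z) hmax |>.filter_mono
      nhdsWithin_le_nhds)

/-! ### Increasing functions on a cube. -/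

theorem inner_pos_of_nonneg_of_pos {n : ℕ} {a v : EuclideanSpace ℝ (Fin n)}
    (ha : ∀ i, 0 ≤ a i) (ha0 : a ≠ 0) (hv : ∀ i, 0 < v i) : 0 < inner ℝ a v := by
  rw [PiLp.inner_apply]
  obtain ⟨i, hi⟩ : ∃ i, a i ≠ 0 := by
    by_contra! h
    exact ha0 (PiLp.ext h)
  refine Finset.sum_pos' (fun j _ => ?_) ⟨i, Finset.mem_univ i, ?_⟩
  · exact mul_nonneg (hv j).le (ha j)
  · exact mul_pos (hv i) (lt_of_le_of_ne (ha i) (Ne.symm hi))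

theorem isOpen_cube (n : ℕ) {I : Set ℝ} (hI : IsOpen I) : IsOpen (cube n I) := by
  simp only [cube, ofPred_forall]
  exact isOpen_iInter_of_finite fun i => hI.preimage (by fun_prop)

theorem convex_cube (n : ℕ) {I : Set ℝ} (hI : Convex ℝ I) : Convex ℝ (cube n I) :=
  fun _ hx _ hy _ _ hs ht hst i => hI (hx i) (hy i) hs ht hst

/-- On a convex set, a continuous function that takes different values at any two points
`x ≫ y` is either increasing or decreasing. -/
theorem isIncreasingOn_or_neg {n : ℕ} {U : Set (EuclideanSpace ℝ (Fin n))} (hU : Convex ℝ U)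
    {u : EuclideanSpace ℝ (Fin n) → ℝ} (hu : ContinuousOn u U)
    (hne : ∀ x ∈ U, ∀ y ∈ U, (∀ i, y i < x i) → u y ≠ u x) :
    IsIncreasingOn U u ∨ IsIncreasingOn U (-u) := by
  -- On this convex set of pairs the difference of values never vanishes, so it has constant sign.
  set D : Set (EuclideanSpace ℝ (Fin n) × EuclideanSpace ℝ (Fin n)) :=
    {p | p ∈ U ×ˢ U ∧ ∀ i, p.2 i < p.1 i} with hD
  have hDconvex : Convex ℝ D := by
    refine fun p hp q hq s t hs ht hst => ⟨hU.prod hU hp.1 hq.1 hs ht hst, fun i => ?_⟩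
    have h1 := hp.2 i
    have h2 := hq.2 i
    simp only [Prod.snd_add, Prod.smul_snd, PiLp.add_apply, PiLp.smul_apply, Prod.fst_add,
      Prod.smul_fst, smul_eq_mul]
    rcases hs.eq_or_lt with rfl | hs
    · simpa [show t = 1 by linarith] using h2
    · nlinarith [mul_lt_mul_of_pos_left h1 hs, mul_le_mul_of_nonneg_left h2.le ht]
  have hF : ContinuousOn (fun p : EuclideanSpace ℝ (Fin n) × EuclideanSpace ℝ (Fin n) =>
      u p.1 - u p.2) D :=
    (hu.comp continuousOn_fst fun p hp => hp.1.1).sub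
      (hu.comp continuousOn_snd fun p hp => hp.1.2)
  by_contra! h
  simp only [IsIncreasingOn, Pi.neg_apply, neg_lt_neg_iff] at h
  push Not at h
  obtain ⟨⟨x, hx, y, hy, hxy, hle⟩, x', hx', y', hy', hxy', hle'⟩ := h
  obtain ⟨p, hp, hp0⟩ := hDconvex.isPreconnected.intermediate_value
    (show (x, y) ∈ D from ⟨⟨hx, hy⟩, hxy⟩) (show (x', y') ∈ D from ⟨⟨hx', hy'⟩, hxy'⟩) hF
    (show (0 : ℝ) ∈ Icc _ _ from ⟨sub_nonpos.2 hle, sub_nonneg.2 hle'⟩)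
  exact hne p.1 hp.1.1 p.2 hp.1.2 hp.2 (sub_eq_zero.1 hp0).symm

/-- Push `x` up the diagonal, which makes the inequalities strict, and let the push tend to `0`. -/
theorem IsIncreasingOn.monotone {n : ℕ} {U : Set (EuclideanSpace ℝ (Fin n))} (hU : IsOpen U)
    {u : EuclideanSpace ℝ (Fin n) → ℝ} (hu : ContinuousOn u U) (hinc : IsIncreasingOn U u)
    {x y : EuclideanSpace ℝ (Fin n)} (hx : x ∈ U) (hy : y ∈ U) (hxy : ∀ i, y i ≤ x i) :
    u y ≤ u x := by
  set o : EuclideanSpace ℝ (Fin n) := WithLp.toLp 2 fun _ => 1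
  have hlim : Tendsto (fun t : ℝ => x + t • o) (𝓝[>] 0) (𝓝 x) := by
    have : ContinuousAt (fun t : ℝ => x + t • o) 0 := by fun_prop
    simpa using this.tendsto.mono_left nhdsWithin_le_nhds
  refine ge_of_tendsto ((hu.continuousAt (hU.mem_nhds hx)).tendsto.comp hlim) ?_
  filter_upwards [hlim.eventually (hU.mem_nhds hx), self_mem_nhdsWithin] with t ht ht0
  have ht0 : 0 < t := ht0
  refine (hinc _ ht y hy fun i => ?_).le
  have := hxy i
  simp [o]
  linarith

/-- Gives room to enlarge the order box spanned by `x` and `y` without leaving the cube. -/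
theorem exists_pos_sub_add_mem {n : ℕ} {I : Set ℝ} (hI : IsOpen I)
    {x y : EuclideanSpace ℝ (Fin n)} (hx : x ∈ cube n I) (hy : y ∈ cube n I) :
    ∃ d : ℝ, 0 < d ∧ ∀ i, min (x i) (y i) - d ∈ I ∧ max (x i) (y i) + d ∈ I := by
  have hev : ∀ i, ∀ᶠ d in 𝓝[>] (0 : ℝ), min (x i) (y i) - d ∈ I ∧ max (x i) (y i) + d ∈ I := by
    intro i
    have hmin : min (x i) (y i) ∈ I := by
      rcases min_choice (x i) (y i) with h | h <;> rw [h]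
      exacts [hx i, hy i]
    have hmax : max (x i) (y i) ∈ I := by
      rcases max_choice (x i) (y i) with h | h <;> rw [h]
      exacts [hx i, hy i]
    have h1 : ContinuousAt (fun d : ℝ => min (x i) (y i) - d) 0 := by fun_prop
    have h2 : ContinuousAt (fun d : ℝ => max (x i) (y i) + d) 0 := by fun_prop
    exact nhdsWithin_le_nhds ((h1.eventually (hI.mem_nhds (by simpa using hmin))).and
      (h2.eventually (hI.mem_nhds (by simpa using hmax))))
  exact (eventually_mem_nhdsWithin.and (eventually_all.2 hev)).exists

/-- The level sets of an increasing continuous function on a cube are connected. -/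
theorem IsIncreasingOn.isPreconnected_levelSetOn {n : ℕ} {I : Set ℝ} (hI : IsOpen I)
    (hIc : Convex ℝ I) {u : EuclideanSpace ℝ (Fin n) → ℝ} (hu : ContinuousOn u (cube n I))
    (hinc : IsIncreasingOn (cube n I) u) (c : ℝ) :
    IsPreconnected (levelSetOn (cube n I) u c) := by
  refine isPreconnected_of_forall_pair fun x hx y hy => ?_
  obtain ⟨hxU, hxc⟩ := hx
  obtain ⟨hyU, hyc⟩ := hy
  obtain ⟨d, hd, hdI⟩ := exists_pos_sub_add_mem hI hxU hyU
  -- The term `|y i - x i|` makes `Z s (±s)` comparable with `x` and `Z s (±(1 - s))` with `y`. The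
  -- term `2 * d` makes `v ≫ 0`, and as `|τ| ≤ m s ≤ 1/2` it moves a coordinate by at most `d`.
  set v : EuclideanSpace ℝ (Fin n) := WithLp.toLp 2 fun i => |y i - x i| + 2 * d with hv
  set Z : ℝ → ℝ → EuclideanSpace ℝ (Fin n) := fun s τ => x + s • (y - x) + τ • v with hZ
  have hZi : ∀ s τ i, Z s τ i = x i + s * (y i - x i) + τ * (|y i - x i| + 2 * d) := fun s τ i => by
    simp [hZ, hv]
  set m : ℝ → ℝ := fun s => min s (1 - s) with hm
  have hm1 : ∀ s, m s ≤ s := fun s => min_le_left _ _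
  have hm2 : ∀ s, m s ≤ 1 - s := fun s => min_le_right _ _
  have hm0 : ∀ s ∈ Icc (0 : ℝ) 1, 0 ≤ m s := fun s hs => le_min hs.1 (sub_nonneg.2 hs.2)
  have hZU : ∀ s ∈ Icc (0 : ℝ) 1, ∀ τ ∈ Icc (-m s) (m s), Z s τ ∈ cube n I := by
    intro s hs τ hτ i
    have h1 := hm1 s
    have h2 := hm2 s
    have h3 := hτ.1
    have h4 := hτ.2
    refine hIc.ordConnected.out (hdI i).1 (hdI i).2 ?_
    rw [hZi, mem_Icc]
    have hd1 : 0 ≤ d * (1 + 2 * τ) := mul_nonneg hd.le (by linarith)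
    have hd2 : 0 ≤ d * (1 - 2 * τ) := mul_nonneg hd.le (by linarith)
    rcases le_total (x i) (y i) with h | h
    · rw [min_eq_left h, max_eq_right h, abs_of_nonneg (sub_nonneg.2 h)]
      have h5 : 0 ≤ (s + τ) * (y i - x i) := mul_nonneg (by linarith) (sub_nonneg.2 h)
      have h6 : 0 ≤ (1 - s - τ) * (y i - x i) := mul_nonneg (by linarith) (sub_nonneg.2 h)
      constructor <;> linarith
    · rw [min_eq_right h, max_eq_left h, abs_of_nonpos (sub_nonpos.2 h)]
      have h5 : 0 ≤ (s - τ) * (x i - y i) := mul_nonneg (by linarith) (sub_nonneg.2 h)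
      have h6 : 0 ≤ (1 - s + τ) * (x i - y i) := mul_nonneg (by linarith) (sub_nonneg.2 h)
      constructor <;> linarith
  have hmono : ∀ s ∈ Icc (0 : ℝ) 1, ∀ τ ∈ Icc (-m s) (m s), ∀ τ' ∈ Icc (-m s) (m s), τ < τ' →
      u (Z s τ) < u (Z s τ') := by
    intro s hs τ hτ τ' hτ' hlt
    refine hinc _ (hZU s hs τ' hτ') _ (hZU s hs τ hτ) fun i => ?_
    rw [hZi, hZi]
    have : 0 < |y i - x i| + 2 * d := by positivity
    gcongr
  have hlow : ∀ s ∈ Icc (0 : ℝ) 1, u (Z s (-m s)) ≤ c := by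
    intro s hs
    have hmem := hZU s hs (-m s) ⟨le_rfl, by linarith [hm0 s hs]⟩
    rcases min_choice s (1 - s) with h | h
    · rw [← hxc]
      refine hinc.monotone (isOpen_cube n hI) hu hxU hmem fun i => ?_
      rw [hZi, show m s = s from h]
      nlinarith [mul_le_mul_of_nonneg_left (le_abs_self (y i - x i)) hs.1, mul_nonneg hs.1 hd.le]
    · rw [← hyc]
      refine hinc.monotone (isOpen_cube n hI) hu hyU hmem fun i => ?_
      rw [hZi, show m s = 1 - s from h]
      have hs' : 0 ≤ 1 - s := by linarith [hs.2]
      nlinarith [mul_le_mul_of_nonneg_left (neg_abs_le (y i - x i)) hs', mul_nonneg hs' hd.le]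
  have hhigh : ∀ s ∈ Icc (0 : ℝ) 1, c ≤ u (Z s (m s)) := by
    intro s hs
    have hmem := hZU s hs (m s) ⟨by linarith [hm0 s hs], le_rfl⟩
    rcases min_choice s (1 - s) with h | h
    · rw [← hxc]
      refine hinc.monotone (isOpen_cube n hI) hu hmem hxU fun i => ?_
      rw [hZi, show m s = s from h]
      nlinarith [mul_le_mul_of_nonneg_left (neg_abs_le (y i - x i)) hs.1, mul_nonneg hs.1 hd.le]
    · rw [← hyc]
      refine hinc.monotone (isOpen_cube n hI) hu hmem hyU fun i => ?_
      rw [hZi, show m s = 1 - s from h]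
      have hs' : 0 ≤ 1 - s := by linarith [hs.2]
      nlinarith [mul_le_mul_of_nonneg_left (le_abs_self (y i - x i)) hs', mul_nonneg hs' hd.le]
  have hex : ∀ s ∈ Icc (0 : ℝ) 1, ∃ τ ∈ Icc (-m s) (m s), u (Z s τ) = c := by
    intro s hs
    have hcont : ContinuousOn (fun τ => u (Z s τ)) (Icc (-m s) (m s)) :=
      hu.comp (by fun_prop) (hZU s hs)
    exact intermediate_value_Icc (by linarith [hm0 s hs]) hcont ⟨hlow s hs, hhigh s hs⟩
  choose! τ hτ hτc using hex
  set Q : Set (ℝ × ℝ) := {p | p.1 ∈ Icc (0 : ℝ) 1 ∧ p.2 ∈ Icc (-m p.1) (m p.1)} with hQ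
  have hQclosed : IsClosed Q :=
    (isClosed_Icc.preimage continuous_fst).and ((isClosed_le (by fun_prop) (by fun_prop)).and
      (isClosed_le (by fun_prop) (by fun_prop)))
  have hΓ : IsClosed (Q ∩ (fun p : ℝ × ℝ => u (Z p.1 p.2)) ⁻¹' {c}) :=
    ContinuousOn.preimage_isClosed_of_isClosed
      (hu.comp (by fun_prop) fun p hp => hZU p.1 hp.1 p.2 hp.2) hQclosed isClosed_singleton
  -- Closed graph with bounded values: every cluster value solves the level equation, whose solution
  -- is unique by `hmono`.
  have hτcont : ContinuousOn τ (Icc 0 1) := by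
    intro s hs
    refine (isCompact_Icc (a := (-1 : ℝ)) (b := 1)).tendsto_nhds_of_unique_mapClusterPt ?_ ?_
    · filter_upwards [self_mem_nhdsWithin] with s' hs'
      have h1 := hτ s' hs'
      have h2 := hm1 s'
      exact ⟨by linarith [h1.1, hs'.2], by linarith [h1.2, hs'.2]⟩
    · intro t _ hcl
      have hmem : (s, t) ∈ Q ∩ (fun p : ℝ × ℝ => u (Z p.1 p.2)) ⁻¹' {c} := by
        by_contra hnot
        obtain ⟨A, hA, B, hB, hAB⟩ := mem_nhds_prod_iff.1 (hΓ.isOpen_compl.mem_nhds hnot)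
        have hA' : ∀ᶠ s' in 𝓝[Icc 0 1] s, s' ∈ A := nhdsWithin_le_nhds hA
        obtain ⟨s', hs'B, hs'A, hs'⟩ := ((mapClusterPt_iff_frequently.1 hcl B hB).and_eventually
          (hA'.and eventually_mem_nhdsWithin)).exists
        exact hAB (mk_mem_prod hs'A hs'B) ⟨⟨hs', hτ s' hs'⟩, hτc s' hs'⟩
      have htc : u (Z s t) = c := hmem.2
      rcases lt_trichotomy t (τ s) with h | h | h
      · exact absurd (hmono s hs t hmem.1.2 _ (hτ s hs) h) (by rw [htc, hτc s hs]; exact lt_irrefl c)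
      · exact h
      · exact absurd (hmono s hs _ (hτ s hs) t hmem.1.2 h) (by rw [htc, hτc s hs]; exact lt_irrefl c)
  have h0 : (0 : ℝ) ∈ Icc (0 : ℝ) 1 := ⟨le_rfl, zero_le_one⟩
  have h1 : (1 : ℝ) ∈ Icc (0 : ℝ) 1 := ⟨zero_le_one, le_rfl⟩
  -- The strip pinches to a point at both ends since `m 0 = m 1 = 0`, so the curve runs from `x` to
  -- `y`.
  have hτ0 : τ 0 = 0 := by simpa [hm] using hτ 0 h0
  have hτ1 : τ 1 = 0 := by simpa [hm] using hτ 1 h1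
  refine ⟨(fun s => Z s (τ s)) '' Icc 0 1, ?_, ⟨0, h0, by simp [hZ, hτ0]⟩,
    ⟨1, h1, by simp [hZ, hτ1]⟩, isPreconnected_Icc.image _ (by fun_prop)⟩
  rintro _ ⟨s, hs, rfl⟩
  exact ⟨hZU s hs _ (hτ s hs), hτc s hs⟩

/-- If two increasing functions on a cube are such that the second is constant on the level sets of
the first, then they induce the same order. -/
theorem IsIncreasingOn.lt_of_lt {n : ℕ} {I : Set ℝ} (hI : IsOpen I) (hIc : Convex ℝ I)
    {u₁ u₂ : EuclideanSpace ℝ (Fin n) → ℝ} (hu₁ : ContinuousOn u₁ (cube n I))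
    (h₁ : IsIncreasingOn (cube n I) u₁) (h₂ : IsIncreasingOn (cube n I) u₂)
    (hconst : ∀ x ∈ cube n I, ∀ y ∈ cube n I, u₁ x = u₁ y → u₂ x = u₂ y)
    {x y : EuclideanSpace ℝ (Fin n)} (hx : x ∈ cube n I) (hy : y ∈ cube n I)
    (hxy : u₁ x < u₁ y) : u₂ x < u₂ y := by
  obtain ⟨d, hd, hdI⟩ := exists_pos_sub_add_mem hI hx hy
  -- The segment from `b` to `t` has direction `≫ 0` and meets the level sets of `u₁` through both
  -- `x` and `y`. Both functions increase along it, so it transfers the order.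
  set b : EuclideanSpace ℝ (Fin n) := WithLp.toLp 2 fun i => min (x i) (y i) - d with hb
  set t : EuclideanSpace ℝ (Fin n) := WithLp.toLp 2 fun i => max (x i) (y i) + d with ht
  have hbU : b ∈ cube n I := fun i => (hdI i).1
  have htU : t ∈ cube n I := fun i => (hdI i).2
  have hbx : u₁ b < u₁ x := h₁ _ hx _ hbU fun i => by
    have := min_le_left (x i) (y i)
    simp only [hb]
    linarith
  have hyt : u₁ y < u₁ t := h₁ _ htU _ hy fun i => by
    have := le_max_right (x i) (y i)
    simp only [ht]
    linarith
  have hbt : ∀ i, 0 < (t - b) i := fun i => by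
    have := min_le_max (a := x i) (b := y i)
    simp only [hb, ht, PiLp.sub_apply]
    linarith
  have hw : ∀ s ∈ Icc (0 : ℝ) 1, b + s • (t - b) ∈ cube n I := fun s hs =>
    (convex_cube n hIc).add_smul_sub_mem hbU htU hs
  have hcont : ContinuousOn (fun s : ℝ => u₁ (b + s • (t - b))) (Icc 0 1) :=
    hu₁.comp (by fun_prop) hw
  have hlt : ∀ {s s' : ℝ}, s < s' → ∀ i, (b + s • (t - b)) i < (b + s' • (t - b)) i :=
    fun {s s'} h i => by
      have := mul_lt_mul_of_pos_right h (hbt i)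
      simpa using this
  have hivt := intermediate_value_Icc zero_le_one hcont
  obtain ⟨s, hs, hsx⟩ := hivt (show u₁ x ∈ _ by
    simpa using ⟨hbx.le, (hxy.trans hyt).le⟩)
  obtain ⟨s', hs', hsy⟩ := hivt (show u₁ y ∈ _ by
    simpa using ⟨(hbx.trans hxy).le, hyt.le⟩)
  simp only at hsx hsy
  have hss : s < s' := by
    by_contra! hle
    rcases hle.eq_or_lt with rfl | hlt'
    · exact hxy.ne (hsx.symm.trans hsy)
    · have := h₁ _ (hw s hs) _ (hw s' hs') (hlt hlt')
      rw [hsx, hsy] at this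
      exact this.asymm hxy
  rw [← hconst _ (hw s hs) x hx hsx, ← hconst _ (hw s' hs') y hy hsy]
  exact h₂ _ (hw s' hs') _ (hw s hs) (hlt hss)

/-! ### Normal solutions on the cube and the conclusion. -/

section NormalSolutionOnCube

variable {n : ℕ} {I : Set ℝ} {g : EuclideanSpace ℝ (Fin n) → EuclideanSpace ℝ (Fin n)}
  {u u₁ u₂ : EuclideanSpace ℝ (Fin n) → ℝ}

theorem IsNormalSolution.apply_ne_of_lt (hI : Convex ℝ I) (hg : LocallyLipschitzOn (cube n I) g)
    (hg0 : ∀ x ∈ cube n I, ∀ i, 0 ≤ g x i) (hgne : ∀ x ∈ cube n I, g x ≠ 0)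
    (hu : IsNormalSolution (cube n I) g (cube n I) u) :
    ∀ x ∈ cube n I, ∀ y ∈ cube n I, (∀ i, y i < x i) → u y ≠ u x :=
  fun _ hx _ hy hlt => hu.apply_ne_of_transversal (convex_cube n hI) hg hx hy fun p hp =>
    (inner_pos_of_nonneg_of_pos (hg0 p hp) (hgne p hp) fun i => sub_pos.2 (hlt i)).ne'

theorem IsNormalSolution.isIncreasingOn_or_neg (hI : Convex ℝ I)
    (hg : LocallyLipschitzOn (cube n I) g)
    (hg0 : ∀ x ∈ cube n I, ∀ i, 0 ≤ g x i) (hgne : ∀ x ∈ cube n I, g x ≠ 0)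
    (hu : IsNormalSolution (cube n I) g (cube n I) u) :
    IsIncreasingOn (cube n I) u ∨ IsIncreasingOn (cube n I) (-u) :=
  _root_.isIncreasingOn_or_neg (convex_cube n hI) hu.locallyLipschitz.continuousOn
    (hu.apply_ne_of_lt hI hg hg0 hgne)

theorem IsRegularSolution.isIncreasingOn (hIo : IsOpen I) (hI : Convex ℝ I) (hIne : I.Nonempty)
    (hg : LocallyLipschitzOn (cube n I) g)
    (hg0 : ∀ x ∈ cube n I, ∀ i, 0 ≤ g x i) (hgne : ∀ x ∈ cube n I, g x ≠ 0)
    (hu : IsRegularSolution (cube n I) g (cube n I) u) : IsIncreasingOn (cube n I) u := by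
  refine (hu.isNormalSolution.isIncreasingOn_or_neg hI hg hg0 hgne).resolve_right fun hneg => ?_
  obtain ⟨c, hc⟩ := hIne
  set z : EuclideanSpace ℝ (Fin n) := WithLp.toLp 2 fun _ => c
  have hz : z ∈ cube n I := fun _ => hc
  obtain ⟨ε, hε, hεU, hmono⟩ := hu.increasing_along z hz
  have h0 : (0 : ℝ) ∈ Ioo (-ε) ε := ⟨by linarith, hε⟩
  have h1 : ε / 2 ∈ Ioo (-ε) ε := ⟨by linarith, by linarith⟩
  have hlt := hmono h0 h1 (half_pos hε)
  -- Coordinates of `g z` may vanish, so only the weak order between `z` and `z + (ε / 2) • g z` is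
  -- available.
  have hle := hneg.monotone (isOpen_cube n hIo)
    hu.isNormalSolution.locallyLipschitz.continuousOn.neg (hεU _ h1) hz fun i => by
      have := mul_nonneg (half_pos hε).le (hg0 z hz i)
      simpa using this
  simp only [zero_smul, add_zero, Pi.neg_apply] at hlt hle
  linarith

theorem IsNormalSolution.isPreconnected_levelSetOn (hIo : IsOpen I) (hI : Convex ℝ I)
    (hg : LocallyLipschitzOn (cube n I) g)
    (hg0 : ∀ x ∈ cube n I, ∀ i, 0 ≤ g x i) (hgne : ∀ x ∈ cube n I, g x ≠ 0)
    (hu : IsNormalSolution (cube n I) g (cube n I) u) (c : ℝ) :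
    IsPreconnected (levelSetOn (cube n I) u c) := by
  have hcont := hu.locallyLipschitz.continuousOn
  rcases hu.isIncreasingOn_or_neg hI hg hg0 hgne with h | h
  · exact h.isPreconnected_levelSetOn hIo hI hcont c
  · have := h.isPreconnected_levelSetOn hIo hI hcont.neg (-c)
    simpa [levelSetOn] using this

/-- A normal solution on a cube is constant on the level sets of every other one. -/
theorem IsNormalSolution.eq_of_eq (hIo : IsOpen I) (hI : Convex ℝ I)
    (hg : LocallyLipschitzOn (cube n I) g)
    (hg0 : ∀ x ∈ cube n I, ∀ i, 0 ≤ g x i) (hgne : ∀ x ∈ cube n I, g x ≠ 0)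
    (hu₁ : IsNormalSolution (cube n I) g (cube n I) u₁)
    (hu₂ : IsNormalSolution (cube n I) g (cube n I) u₂) :
    ∀ x ∈ cube n I, ∀ y ∈ cube n I, u₁ x = u₁ y → u₂ x = u₂ y := by
  intro x hx y hy hxy
  -- By connectedness it is enough that `u₂` be locally constant on the level set of `u₁`.
  refine (hu₁.isPreconnected_levelSetOn hIo hI hg hg0 hgne (u₁ x)).induction₂
    (fun p q => u₂ p = u₂ q) (fun z hz => ?_) (fun _ _ _ _ _ _ h h' => h.trans h')
    (fun _ _ _ _ h => h.symm) ⟨hx, rfl⟩ ⟨hy, hxy.symm⟩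
  set v : EuclideanSpace ℝ (Fin n) := WithLp.toLp 2 fun _ => 1 with hv
  have hline : ContinuousAt (fun τ : ℝ => z + τ • v) 0 := by fun_prop
  obtain ⟨ε, hε, hεU⟩ := Metric.eventually_nhds_iff.1
    (hline.eventually ((isOpen_cube n hIo).mem_nhds (by simpa using hz.1)))
  have hnear := IsNormalSolution.exists_common_level_point hg (u := ![u₁, u₂])
    (by intro i; fin_cases i; exacts [hu₁, hu₂])
    (fun p hp => (inner_pos_of_nonneg_of_pos (v := v) (hg0 p hp) (hgne p hp)
      fun i => one_pos).ne') hz.1 hε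
  filter_upwards [nhdsWithin_le_nhds hnear, self_mem_nhdsWithin] with z' ⟨τ, hτ, hτu⟩ hz'
  have hτU : z + τ • v ∈ cube n I := hεU (by simpa using hτ)
  have h1 : u₁ (z + τ • v) = u₁ z := (hτu 0).trans (hz'.2.trans hz.2.symm)
  have hne := hu₁.apply_ne_of_lt hI hg hg0 hgne
  -- `u₁` is injective along the diagonal through `z`, so the common level point is `z` itself.
  have hτ0 : τ = 0 := by
    rcases lt_trichotomy τ 0 with h | h | h
    · exact absurd h1 (hne z hz.1 _ hτU fun i => by simpa [hv] using h)
    · exact h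
    · exact absurd h1.symm (hne _ hτU z hz.1 fun i => by simpa [hv] using h)
  simpa [hτ0] using hτu 1

theorem IsNormalSolution.isMonotoneTransformOn (hIo : IsOpen I) (hI : Convex ℝ I)
    (hg : LocallyLipschitzOn (cube n I) g)
    (hg0 : ∀ x ∈ cube n I, ∀ i, 0 ≤ g x i) (hgne : ∀ x ∈ cube n I, g x ≠ 0)
    (hu₁ : IsNormalSolution (cube n I) g (cube n I) u₁)
    (hu₂ : IsNormalSolution (cube n I) g (cube n I) u₂) :
    IsMonotoneTransformOn (cube n I) u₁ u₂ := by
  have hconst := hu₁.eq_of_eq hIo hI hg hg0 hgne hu₂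
  have hcont := hu₁.locallyLipschitz.continuousOn
  have hφ : ∀ x ∈ cube n I, u₂ x = (u₂ ∘ Function.invFunOn u₁ (cube n I)) (u₁ x) := fun x hx =>
    hconst x hx _ (Function.invFunOn_mem ⟨x, hx, rfl⟩) (Function.invFunOn_eq ⟨x, hx, rfl⟩).symm
  refine ⟨u₂ ∘ Function.invFunOn u₁ (cube n I), ?_, hφ⟩
  have hmono : (∀ x ∈ cube n I, ∀ y ∈ cube n I, u₁ x < u₁ y → u₂ x < u₂ y) →
      StrictMonoOn (u₂ ∘ Function.invFunOn u₁ (cube n I)) (u₁ '' cube n I) := by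
    rintro h _ ⟨x, hx, rfl⟩ _ ⟨y, hy, rfl⟩ hxy
    rw [← hφ x hx, ← hφ y hy]
    exact h x hx y hy hxy
  have hanti : (∀ x ∈ cube n I, ∀ y ∈ cube n I, u₁ x < u₁ y → u₂ y < u₂ x) →
      StrictAntiOn (u₂ ∘ Function.invFunOn u₁ (cube n I)) (u₁ '' cube n I) := by
    rintro h _ ⟨x, hx, rfl⟩ _ ⟨y, hy, rfl⟩ hxy
    rw [← hφ x hx, ← hφ y hy]
    exact h x hx y hy hxy
  have hconst₁ : ∀ x ∈ cube n I, ∀ y ∈ cube n I, (-u₁) x = (-u₁) y → u₂ x = u₂ y :=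
    fun x hx y hy h => hconst x hx y hy (neg_injective h)
  -- Changing the sign of a decreasing solution reduces each case to `IsIncreasingOn.lt_of_lt`; `φ`
  -- is increasing exactly when the two signs agree.
  rcases hu₁.isIncreasingOn_or_neg hI hg hg0 hgne with h₁ | h₁ <;>
    rcases hu₂.isIncreasingOn_or_neg hI hg hg0 hgne with h₂ | h₂
  · exact Or.inl (hmono fun x hx y hy hxy => h₁.lt_of_lt hIo hI hcont h₂ hconst hx hy hxy)
  · exact Or.inr (hanti fun x hx y hy hxy => neg_lt_neg_iff.1 (h₁.lt_of_lt hIo hI hcont h₂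
      (fun x hx y hy h => congrArg Neg.neg (hconst x hx y hy h)) hx hy hxy))
  · exact Or.inr (hanti fun x hx y hy hxy => h₁.lt_of_lt hIo hI hcont.neg h₂ hconst₁ hy hx
      (neg_lt_neg hxy))
  · exact Or.inl (hmono fun x hx y hy hxy => neg_lt_neg_iff.1 (h₁.lt_of_lt hIo hI hcont.neg h₂
      (fun x hx y hy h => congrArg Neg.neg (hconst₁ x hx y hy h)) hy hx (neg_lt_neg hxy)))

end NormalSolutionOnCube

theorem mainTheorem8 (n : ℕ) (I : Set ℝ) (hI_open : IsOpen I) (hI_conv : Convex ℝ I)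
    (hI_ne : I.Nonempty)
    (g : EuclideanSpace ℝ (Fin n) → EuclideanSpace ℝ (Fin n))
    (hg_lip : LocallyLipschitzOn (cube n I) g)
    (hg_nonneg : ∀ x ∈ cube n I, ∀ i, 0 ≤ g x i)
    (hg_ne : ∀ x ∈ cube n I, g x ≠ 0) :
    (∀ u : EuclideanSpace ℝ (Fin n) → ℝ, IsRegularSolution (cube n I) g (cube n I) u →
      IsIncreasingOn (cube n I) u ∧
        ∀ c ∈ u '' cube n I, IsConnected (levelSetOn (cube n I) u c)) ∧
    (∀ u₁ u₂ : EuclideanSpace ℝ (Fin n) → ℝ,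
      IsNormalSolution (cube n I) g (cube n I) u₁ →
      IsNormalSolution (cube n I) g (cube n I) u₂ →
      IsMonotoneTransformOn (cube n I) u₁ u₂) := by
  refine ⟨fun u hu => ⟨hu.isIncreasingOn hI_open hI_conv hI_ne hg_lip hg_nonneg hg_ne, ?_⟩,
    fun u₁ u₂ hu₁ hu₂ => hu₁.isMonotoneTransformOn hI_open hI_conv hg_lip hg_nonneg hg_ne hu₂⟩
  rintro _ ⟨x, hx, rfl⟩
  exact ⟨⟨x, hx, rfl⟩, hu.isNormalSolution.isPreconnected_levelSetOn hI_open hI_conv hg_lip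
    hg_nonneg hg_ne _⟩
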